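/- Let $p$ be a prime and let $\chi_p(n)=\left(\frac{n}{p}\right)$ be the Legendre symbol, regarded as a Dirichlet character modulo $p$. For real $a<b$ put $q(a,b)=\sum_{a<n<b}\chi_p(n)$, the sum being over all integers $n$ with $a<n<b$. Let $\chi_4$ be the Dirichlet character modulo $4$ with $\chi_4(n)=(-1)^{(n-1)/2}$ for $n$ odd and $\chi_4(n)=0$ for $n$ even, let $\chi_3(n)=\left(\frac n3\right)$, and put $\chi_{4p}=\chi_4\chi_p$ (for $p\ne 2$) and $\chi_{3p}=\chi_3\chi_p$ (for $p\neq 3$), pointwise products, which are Dirichlet characters modulo $4p$ and $3p$. For a nonprincipal Dirichlet character $\chi$ let $L(1,\chi)=\sum_{n=1}^{\infty}\chi(n)/n$ (a convergent series, whose sum is the value at $s=1$ of the analytic continuation of $L(s,\chi)=\sum_{n\ge1}\chi(n)n^{-s}$). Then: (i) If $p\equiv 3 \pmod 4$, then $$q(0,p/2)=\sum_{0<n<p/2}\chi_p(n)>0\quad\text{and}\quad q(0,p/2)=\frac{\sqrt p}{\pi}\,\bigl(2-\chi_p(2)\bigr)\,L(1,\chi_p).$$ (ii) If $p\equiv 1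 \pmod 4$, then $$q(0,p/4)=\sum_{0<n<p/4}\chi_p(n)>0\quad\text{and}\quad q(0,p/4)=\frac{\sqrt p}{\pi}\,L(1,\chi_{4p}).$$ (iii) If $p>3$, then $q(0,p/3)=\sum_{0<n<p/3}\chi_p(n)>0$. Moreover, if $p>3$ and $p\equiv 1\pmod 4$, then $$q(0,p/3)=\frac{\sqrt{3p}}{2\pi}\,L(1,\chi_{3p}),$$ and if $p>3$ and $p\equiv 3\pmod 4$, then $$q(0,p/3)=\frac{\sqrt p}{2\pi}\,\bigl(3-\chi_p(3)\bigr)\,L(1,\chi_p).$$ In each of these formulae the factor in front of the $L$-value is a positive real number, and the character occurring in the $L$-value is real-valued and nonprincipal. -/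

import Mathlib

open Filter Topology

/-- The sum `q(a, b)` of the Legendre symbols `(n / p)` over all integers `n` with `a < n < b`. -/
noncomputable def quadraticExcess (p : ℕ) [Fact p.Prime] (a b : ℝ) : ℤ :=
  ∑ n ∈ Finset.Ioo ⌊a⌋ ⌈b⌉, legendreSym p n

/-- The range of summation in `quadraticExcess` is the set of integers in the open interval. -/
theorem mem_Ioo_floor_ceil_iff (a b : ℝ) (n : ℤ) :
    n ∈ Finset.Ioo ⌊a⌋ ⌈b⌉ ↔ a < n ∧ (n : ℝ) < b := by
  rw [Finset.mem_Ioo, Int.floor_lt, Int.lt_ceil]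

/-- The Legendre symbol modulo a prime `p` as a (complex valued) Dirichlet character. -/
noncomputable def legendreChar (p : ℕ) [Fact p.Prime] : DirichletCharacter ℂ p :=
  (quadraticChar (ZMod p)).ringHomComp (Int.castRingHom ℂ)

theorem legendreChar_apply (p : ℕ) [Fact p.Prime] (n : ℤ) :
    legendreChar p (n : ZMod p) = (legendreSym p n : ℂ) := rfl

/-- The nonprincipal Dirichlet character modulo `4`. -/
noncomputable def chiFour : DirichletCharacter ℂ 4 :=
  ZMod.χ₄.ringHomComp (Int.castRingHom ℂ)

theorem chiFour_apply (n : ℤ) :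
    chiFour (n : ZMod 4) = if n % 2 = 0 then 0 else if n % 4 = 1 then 1 else -1 := by
  have h : chiFour (n : ZMod 4) = ((ZMod.χ₄ (n : ZMod 4) : ℤ) : ℂ) := rfl
  rw [h, ZMod.χ₄_int_eq_if_mod_four]
  split_ifs <;> simp

/-- The product of a character modulo `m` and a character modulo `n`, a character modulo
`m * n`. -/
noncomputable def prodChar {m n : ℕ} (χ : DirichletCharacter ℂ m) (ψ : DirichletCharacter ℂ n) :
    DirichletCharacter ℂ (m * n) :=
  DirichletCharacter.changeLevel (dvd_mul_right m n) χ *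
    DirichletCharacter.changeLevel (dvd_mul_left n m) ψ

/-- `prodChar` is the pointwise product on the integers. -/
theorem prodChar_apply {m n : ℕ} (χ : DirichletCharacter ℂ m) (ψ : DirichletCharacter ℂ n)
    (k : ℤ) : prodChar χ ψ (k : ZMod (m * n)) = χ (k : ZMod m) * ψ (k : ZMod n) := by
  by_cases hk : IsUnit (k : ZMod (m * n))
  · obtain ⟨u, hu⟩ := hk
    have h1 : ((u : ZMod (m * n)).cast : ZMod m) = (k : ZMod m) := by
      rw [hu]; exact ZMod.cast_intCast (dvd_mul_right m n) k
    have h2 : ((u : ZMod (m * n)).cast : ZMod n) = (k : ZMod n) := by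
      rw [hu]; exact ZMod.cast_intCast (dvd_mul_left n m) k
    rw [← hu, prodChar, MulChar.mul_apply,
      DirichletCharacter.changeLevel_eq_cast_of_dvd, DirichletCharacter.changeLevel_eq_cast_of_dvd,
      h1, h2]
  · rw [MulChar.map_nonunit _ hk]
    rw [ZMod.coe_int_isUnit_iff_isCoprime] at hk
    have : ¬ IsUnit (k : ZMod m) ∨ ¬ IsUnit (k : ZMod n) := by
      by_contra! h
      rw [ZMod.coe_int_isUnit_iff_isCoprime, ZMod.coe_int_isUnit_iff_isCoprime] at h
      exact hk (by push_cast; exact h.1.mul_left h.2)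
    rcases this with h | h <;> simp [MulChar.map_nonunit _ h]

/-- `χ` is a real nonprincipal character, the series `∑ χ(n) / n` over `n = 1, 2, 3, …`
(summed in this order) converges to `L(1, χ)`, the real number `c` is positive, and
`x = c * L(1, χ)`. -/
def IsPositiveMultipleOfLOne {N : ℕ} [NeZero N] (x c : ℝ) (χ : DirichletCharacter ℂ N) : Prop :=
  (∀ a : ZMod N, (χ a).im = 0) ∧ χ ≠ 1 ∧
    Tendsto (fun M : ℕ ↦ ∑ n ∈ Finset.Icc 1 M, χ (n : ZMod N) / (n : ℂ)) atTop
      (𝓝 (χ.LFunction 1)) ∧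
    0 < c ∧ (x : ℂ) = (c : ℂ) * χ.LFunction 1

/-! ### The sign of the quadratic Gauss sum, by reduction modulo p -/

section GaussSumSign

open Polynomial

/-! The quadratic Gauss sum `τ` equals `√p` or `i√p` according to `p` modulo 4
(`gaussSum_legendreChar`). Hence `√p · χ_p(n)` is a finite combination of cosines `cos(2πna/p)` if
`p ≡ 1 (mod 4)`, or sines if `p ≡ 3`. For `p ≡ 1`, multiplying by `χ_4(n) = sin(2πn/4)` or `χ_3(n) =
(2/√3) sin(2πn/3)` gives sines of frequency `1/k + a/p`. In every case the character is odd and a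
sum of sine waves, so `∑ sin(2πnx)/n = π(1/2 - x)` on `0 < x < 1` turns `L(1, χ)` into a finite sum
of `χ_p(a)` against a sawtooth (`LFunction_one_of_eq_sum_sin`).

That finite sum is a multiple of `q(0, p/k)`, because the integer jumps of the sawtooth are
indicators of intervals of length `p/k` (`sub_mul_sum_sawtooth`,
`sum_quadraticChar_mul_sawtooth_shift`).

Positivity of `q` is positivity of `L(1, χ)`: for real `χ` the Euler product is nonnegative for `s >
1`, and `L(1, χ) ≠ 0` (`LFunction_one_re_pos`).

The sign of `τ` is the delicate point. Both `τ` and the sine product `∏ (ζ^k - ζ^(-k))` over `1 ≤ k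
≤ (p-1)/2` have square `(-1)^((p-1)/2) p`, so they differ by a sign `ε`. Comparing leading terms at
`X = 1` of the two polynomials modulo `p` yields `ε = (-2/p)`. -/

theorem exists_iterate_X_mul_derivative_X_sub_one_pow {R : Type*} [CommRing R] (n i : ℕ)
    (hi : i ≤ n) :
    ∃ D : R[X], (fun f : R[X] ↦ X * derivative f)^[i] ((X - 1) ^ n) = (X - 1) ^ (n - i) * D ∧
      D.eval 1 = (n.descFactorial i : R) := by
  induction i with
  | zero => exact ⟨1, by simp, by simp⟩
  | succ i ih =>
    obtain ⟨D, hD, hD1⟩ := ih (by omega)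
    obtain ⟨k, hk⟩ : ∃ k, n - i = k + 1 := ⟨n - i - 1, by omega⟩
    have hk' : n - (i + 1) = k := by omega
    -- The operator `X d/dX` lowers the order of vanishing at 1 by one and multiplies the leading
    -- coefficient there by the old order `k + 1`.
    refine ⟨X * ((k + 1 : R[X]) * D + (X - 1) * derivative D), ?_, ?_⟩
    · rw [Function.iterate_succ_apply', hD, hk, hk', derivative_mul, derivative_pow]
      simp
      ring
    · rw [Nat.descFactorial_succ, hk]
      simp [hD1]

theorem iterate_X_mul_derivative_sum_X_pow {R : Type*} [CommRing R] (n i : ℕ) :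
    (fun f : R[X] ↦ X * derivative f)^[i] (∑ j ∈ Finset.range n, X ^ j) =
      ∑ j ∈ Finset.range n, C ((j : R) ^ i) * X ^ j := by
  induction i with
  | zero => simp
  | succ i ih =>
    rw [Function.iterate_succ_apply', ih, derivative_sum, Finset.mul_sum]
    refine Finset.sum_congr rfl fun j _ ↦ ?_
    rcases j with _ | j
    · rcases i with _ | i <;> simp
    · simp only [derivative_C_mul_X_pow, Nat.add_sub_cancel, pow_succ _ i, C_mul]
      ring

theorem descFactorial_pred_cast_zmod (p m : ℕ) [Fact p.Prime] (hm : m ≤ p - 1) :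
    ((p - 1).descFactorial m : ZMod p) = (-1) ^ m * (m.factorial : ZMod p) := by
  have hp := (Fact.out : p.Prime).pos
  rw [Nat.descFactorial_eq_prod_range, ← Finset.prod_range_add_one_eq_factorial, Nat.cast_prod,
    Nat.cast_prod, ← Finset.card_range m, ← Finset.prod_const, Finset.card_range,
    ← Finset.prod_mul_distrib]
  refine Finset.prod_congr rfl fun i hi ↦ ?_
  rw [Finset.mem_range] at hi
  have : ((p - 1 - i : ℕ) : ZMod p) + (i + 1 : ℕ) = 0 := by
    rw [← Nat.cast_add, show p - 1 - i + (i + 1) = p by omega, ZMod.natCast_self]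
  rw [eq_neg_of_add_eq_zero_left this]
  ring

/-- Each factor has a zero at 1 with derivative `(k + 1) - (p - (k + 1)) ≡ 2(k + 1)` modulo `p`. -/
theorem exists_prod_X_pow_sub_X_pow_eq (p m : ℕ) [Fact p.Prime] (hm : p = 2 * m + 1) :
    ∃ E : (ZMod p)[X],
      ∏ k ∈ Finset.range m, (X ^ (k + 1) - X ^ (p - (k + 1)) : (ZMod p)[X]) = (X - 1) ^ m * E ∧
      E.eval 1 = 2 ^ m * (m.factorial : ZMod p) := by
  refine ⟨∏ k ∈ Finset.range m, (∑ i ∈ Finset.range (k + 1), X ^ i -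
    ∑ i ∈ Finset.range (p - (k + 1)), X ^ i), ?_, ?_⟩
  · nth_rw 2 [← Finset.card_range m]
    rw [← Finset.prod_const, ← Finset.prod_mul_distrib]
    refine Finset.prod_congr rfl fun k _ ↦ ?_
    rw [mul_sub, mul_geom_sum, mul_geom_sum]
    ring
  · rw [eval_prod, ← Finset.prod_range_add_one_eq_factorial, Nat.cast_prod]
    rw [show (2 : ZMod p) ^ m = ∏ _k ∈ Finset.range m, 2 by simp, ← Finset.prod_mul_distrib]
    refine Finset.prod_congr rfl fun k hk ↦ ?_
    rw [Finset.mem_range] at hk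
    have : ((p - (k + 1) : ℕ) : ZMod p) + (k + 1 : ℕ) = 0 := by
      rw [← Nat.cast_add, show p - (k + 1) + (k + 1) = p by omega, ZMod.natCast_self]
    simp only [eval_sub, eval_finsetSum, eval_pow, eval_X, one_pow, Finset.sum_const,
      Finset.card_range, nsmul_eq_mul, mul_one]
    rw [eq_neg_of_add_eq_zero_left this]
    ring

/-- The generating polynomial of the Legendre symbol modulo `p`. -/
noncomputable def legendrePoly (p : ℕ) [Fact p.Prime] : ℤ[X] :=
  ∑ j ∈ Finset.range p, C (legendreSym p j) * X ^ j

/-- The polynomial whose value at `exp (2πi/p)` is, up to powers of `2i`, a product of sines. -/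
noncomputable def sineProdPoly (p : ℕ) : ℤ[X] :=
  ∏ k ∈ Finset.range (p / 2), (X ^ (k + 1) - X ^ (p - (k + 1)))

/-- Put `m = (p-1)/2`. Modulo `p` the cyclotomic polynomial is `(X - 1)^(2m)`. By Euler's criterion
`legendrePoly` is `(X d/dX)^m` applied to it, so it has leading coefficient `(-1)^m m!` at order
`m`; that of `sineProdPoly` is `2^m m!`. Divisibility forces `(-1)^m = ε 2^m`. -/
theorem eq_legendreSym_neg_two_of_cyclotomic_dvd (p : ℕ) [Fact p.Prime] (hp2 : p ≠ 2) (ε : ℤ)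
    (hε : ε = 1 ∨ ε = -1) (h : cyclotomic p ℤ ∣ legendrePoly p - C ε * sineProdPoly p) :
    ε = legendreSym p (-2) := by
  have hp : p.Prime := Fact.out
  obtain ⟨m, hm⟩ : ∃ m, p = 2 * m + 1 := hp.odd_of_ne_two hp2
  have hm2 : p / 2 = m := by omega
  have hm0 : 0 < m := by have := hp.two_le; omega
  obtain ⟨D, hD, hD1⟩ := exists_iterate_X_mul_derivative_X_sub_one_pow (R := ZMod p) (p - 1) m
    (by omega)
  obtain ⟨E, hE, hE1⟩ := exists_prod_X_pow_sub_X_pow_eq p m hm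
  have hcyc : cyclotomic p (ZMod p) = (X - 1) ^ (p - 1) := by
    have := cyclotomic_mul_prime_eq_pow_of_not_dvd (ZMod p) (p := p) (n := 1)
      (by simpa using hp.one_lt.ne')
    simpa using this
  have hA : (legendrePoly p).map (Int.castRingHom (ZMod p)) = (X - 1) ^ m * D := by
    rw [show p - 1 - m = m by omega] at hD
    rw [← hD, ← hcyc, cyclotomic_prime, iterate_X_mul_derivative_sum_X_pow, legendrePoly,
      Polynomial.map_sum]
    refine Finset.sum_congr rfl fun j _ ↦ ?_
    have := legendreSym.eq_pow p (j : ℤ)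
    rw [hm2] at this
    rw [Polynomial.map_mul, map_C, Polynomial.map_pow, map_X, eq_intCast, this, Int.cast_natCast]
  have hB : (sineProdPoly p).map (Int.castRingHom (ZMod p)) = (X - 1) ^ m * E := by
    rw [← hE, sineProdPoly, Polynomial.map_prod, hm2]
    simp
  have h1 := Polynomial.map_dvd (Int.castRingHom (ZMod p)) h
  rw [map_cyclotomic, hcyc, Polynomial.map_sub, Polynomial.map_mul, hA, hB, map_C,
    show p - 1 = m + m by omega, pow_add,
    show (X - 1) ^ m * D - C ((Int.castRingHom (ZMod p)) ε) * ((X - 1) ^ m * E) =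
      (X - 1) ^ m * (D - C ((Int.castRingHom (ZMod p)) ε) * E) by ring] at h1
  have hX : (X - 1 : (ZMod p)[X]) ≠ 0 := by simpa using X_sub_C_ne_zero (1 : ZMod p)
  have h2 := (mul_dvd_mul_iff_left (pow_ne_zero m hX)).1 h1
  have h3 : eval 1 (D - C ((Int.castRingHom (ZMod p)) ε) * E) = 0 := by
    obtain ⟨F, hF⟩ := h2
    rw [hF]
    simp [hm0.ne']
  rw [eval_sub, eval_mul, eval_C, hD1, hE1, descFactorial_pred_cast_zmod p m (by omega),
    ← mul_assoc, ← sub_mul] at h3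
  have hfac : (m.factorial : ZMod p) ≠ 0 := by
    rw [Ne, ZMod.natCast_eq_zero_iff, hp.dvd_factorial]
    omega
  have h4 := sub_eq_zero.1 ((mul_eq_zero.1 h3).resolve_right hfac)
  have hε2 : ((ε : ZMod p)) * ε = 1 := by rcases hε with rfl | rfl <;> simp
  have h5 : ((legendreSym p (-2) : ℤ) : ZMod p) = (ε : ZMod p) := by
    rw [legendreSym.eq_pow, hm2]
    push_cast
    rw [neg_pow, h4, eq_intCast]
    have h6 : (2 : ZMod p) ^ m * 2 ^ m = ((legendreSym p 2 * legendreSym p 2 : ℤ) : ZMod p) := by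
      have := legendreSym.eq_pow p 2
      rw [hm2] at this
      push_cast at this ⊢
      rw [this]
    have h20 : ((2 : ℤ) : ZMod p) ≠ 0 := by
      intro h0
      rw [ZMod.intCast_zmod_eq_zero_iff_dvd] at h0
      have := Int.le_of_dvd two_pos h0
      have := hp.two_le
      omega
    rw [mul_assoc, h6, ← sq, legendreSym.sq_one p h20]
    simp
  have h6 : legendreSym p (-2) = 1 ∨ legendreSym p (-2) = -1 := by
    apply legendreSym.eq_one_or_neg_one
    rw [legendreSym.eq_pow] at h5
    intro h0
    rw [h0, zero_pow (by omega)] at h5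
    rw [← h5, zero_mul] at hε2
    exact zero_ne_one hε2
  -- Both sides are `±1`, so the congruence modulo `p > 2` is an equality of integers.
  have : Fact (2 < p) := ⟨by have := hp.two_le; omega⟩
  have hne := ZMod.neg_one_ne_one (n := p)
  rcases hε with rfl | rfl <;> rcases h6 with h6 | h6 <;> rw [h6] at h5 ⊢
  · exact absurd (by simpa using h5) hne
  · exact absurd (by simpa using h5.symm) hne

end GaussSumSign

/-! ### The value of the Gauss sum and the Fourier expansion of the Legendre symbol -/

section GaussSumValue

open Complex Polynomial

theorem sum_zmod_val_eq_sum_range {M : Type*} [AddCommMonoid M] (p : ℕ) [NeZero p] (f : ℕ → M) :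
    ∑ a : ZMod p, f a.val = ∑ j ∈ Finset.range p, f j := by
  refine Finset.sum_nbij' ZMod.val (fun j ↦ (j : ZMod p)) ?_ ?_ ?_ ?_ ?_
  · intro a _
    simpa using a.val_lt
  · simp
  · intro a _
    simp
  · intro j hj
    exact ZMod.val_cast_of_lt (by simpa using hj)
  · simp

theorem stdAddChar_eq_pow_val (p : ℕ) [NeZero p] (a : ZMod p) :
    ZMod.stdAddChar a = exp (2 * Real.pi * I / p) ^ a.val := by
  rw [← exp_nat_mul]
  have := ZMod.stdAddChar_coe (N := p) a.val
  rw [Int.cast_natCast, ZMod.natCast_zmod_val] at this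
  rw [this]
  congr 1
  push_cast
  ring

theorem aeval_legendrePoly (p : ℕ) [Fact p.Prime] :
    aeval (exp (2 * Real.pi * I / p)) (legendrePoly p) =
      gaussSum (legendreChar p) ZMod.stdAddChar := by
  rw [gaussSum, legendrePoly, map_sum, ← sum_zmod_val_eq_sum_range]
  refine Finset.sum_congr rfl fun a _ ↦ ?_
  rw [stdAddChar_eq_pow_val, map_mul, map_pow, aeval_X, aeval_C, eq_intCast,
    ← legendreChar_apply p a.val]
  simp

theorem legendreChar_ne_one (p : ℕ) [Fact p.Prime] (hp2 : p ≠ 2) : legendreChar p ≠ 1 := by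
  rw [legendreChar, Ne, MulChar.ringHomComp_eq_one_iff (Int.castRingHom ℂ).injective_int]
  exact quadraticChar_ne_one (by rwa [ZMod.ringChar_zmod_n])

theorem gaussSum_legendreChar_sq (p : ℕ) [Fact p.Prime] (hp2 : p ≠ 2) :
    gaussSum (legendreChar p) ZMod.stdAddChar ^ 2 = (-1) ^ (p / 2) * p := by
  rw [gaussSum_sq (legendreChar_ne_one p hp2)
    ((quadraticChar_isQuadratic (ZMod p)).comp _) (ZMod.isPrimitive_stdAddChar p), ZMod.card]
  have h := legendreChar_apply p (-1)
  rw [legendreSym.at_neg_one hp2, ZMod.χ₄_eq_neg_one_pow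
    ((Nat.Prime.eq_two_or_odd Fact.out).resolve_left hp2)] at h
  push_cast at h
  rw [h]

/-- Since `p` is odd, `z^2` is again primitive, so `∏ (1 - z^(2k)) = p` over `0 < k < p`. Pairing
`k` with `p - k` gives `(1 - z^(2k))(1 - z^(-2k)) = -(z^k - z^(-k))^2`. -/
theorem aeval_sineProdPoly_sq (p : ℕ) [Fact p.Prime] (hp2 : p ≠ 2) {z : ℂ}
    (hz : IsPrimitiveRoot z p) :
    aeval z (sineProdPoly p) ^ 2 = (-1) ^ (p / 2) * p := by
  have hp : p.Prime := Fact.out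
  obtain ⟨m, hm⟩ : ∃ m, p = 2 * m + 1 := hp.odd_of_ne_two hp2
  have hm2 : p / 2 = m := by omega
  have hη : IsPrimitiveRoot (z ^ 2) (p - 1 + 1) := by
    rw [Nat.sub_add_cancel hp.pos]
    exact hz.pow_of_coprime 2 ((Nat.coprime_primes Nat.prime_two hp).2 hp2.symm)
  have h := hη.prod_one_sub_pow_eq_order
  rw [show p - 1 = m + m by omega, Finset.prod_range_add,
    ← Finset.prod_range_reflect (fun k ↦ 1 - (z ^ 2) ^ (m + k + 1)) m,
    ← Finset.prod_mul_distrib] at h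
  have hpc : (p : ℂ) = ((m + m : ℕ) : ℂ) + 1 := by
    rw [hm]
    push_cast
    ring
  rw [hpc, ← h, sineProdPoly, map_prod, hm2, ← Finset.prod_pow,
    show (-1 : ℂ) ^ m = ∏ _k ∈ Finset.range m, (-1) by simp, ← Finset.prod_mul_distrib]
  refine Finset.prod_congr rfl fun k hk ↦ ?_
  rw [Finset.mem_range] at hk
  have hxy : z ^ (k + 1) * z ^ (p - (k + 1)) = 1 := by
    rw [← pow_add, show k + 1 + (p - (k + 1)) = p by omega, hz.pow_eq_one]
  rw [show m + (m - 1 - k) + 1 = p - (k + 1) by omega, map_sub, map_pow, map_pow, aeval_X,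
    ← pow_mul, ← pow_mul, mul_comm 2, mul_comm 2, pow_mul, pow_mul]
  linear_combination (z ^ (k + 1) * z ^ (p - (k + 1)) - 1) * hxy

/-- Each factor is `2i sin(2πk/p)` with `0 < 2πk/p < π`, so all the sines are positive. -/
theorem exists_aeval_sineProdPoly_eq (p : ℕ) [Fact p.Prime] (hp2 : p ≠ 2) :
    ∃ r : ℝ, 0 < r ∧ aeval (exp (2 * Real.pi * I / p)) (sineProdPoly p) = I ^ (p / 2) * r := by
  have hp : p.Prime := Fact.out
  have hp0 : (0 : ℝ) < p := by exact_mod_cast hp.pos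
  have hz := isPrimitiveRoot_exp p hp.ne_zero
  refine ⟨∏ k ∈ Finset.range (p / 2), 2 * Real.sin (2 * Real.pi * (k + 1) / p),
    Finset.prod_pos fun k hk ↦ ?_, ?_⟩
  · rw [Finset.mem_range] at hk
    refine mul_pos two_pos (Real.sin_pos_of_pos_of_lt_pi (by positivity) ?_)
    rw [div_lt_iff₀ hp0]
    have : (2 * (k + 1) : ℝ) < p := by
      have : 2 * (k + 1) < p := by have := hp.odd_of_ne_two hp2; grind
      exact_mod_cast this
    nlinarith [Real.pi_pos]
  · rw [sineProdPoly, map_prod, show I ^ (p / 2) = ∏ _k ∈ Finset.range (p / 2), I by simp,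
      ofReal_prod, ← Finset.prod_mul_distrib]
    refine Finset.prod_congr rfl fun k hk ↦ ?_
    rw [Finset.mem_range] at hk
    have hxy : exp (2 * Real.pi * I / p) ^ (k + 1) * exp (2 * Real.pi * I / p) ^ (p - (k + 1)) =
        1 := by
      rw [← pow_add, show k + 1 + (p - (k + 1)) = p by omega, hz.pow_eq_one]
    rw [map_sub, map_pow, map_pow, aeval_X, eq_inv_of_mul_eq_one_right hxy, ← exp_nat_mul,
      ← exp_neg]
    push_cast
    rw [Complex.sin, show ((k : ℂ) + 1) * (2 * Real.pi * I / p) =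
      2 * Real.pi * (k + 1) / p * I by ring, neg_mul]
    linear_combination (exp (2 * Real.pi * (k + 1) / p * I) -
      exp (-(2 * Real.pi * (k + 1) / p * I))) * I_mul_I

theorem gaussSum_legendreChar (p : ℕ) [Fact p.Prime] (hp2 : p ≠ 2) :
    gaussSum (legendreChar p) ZMod.stdAddChar = if p % 4 = 1 then (√p : ℂ) else I * (√p : ℂ) := by
  have hp : p.Prime := Fact.out
  have hp1 : p % 2 = 1 := hp.eq_two_or_odd.resolve_left hp2
  have hz := isPrimitiveRoot_exp p hp.ne_zero
  have h1 := gaussSum_legendreChar_sq p hp2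
  have h2 := aeval_sineProdPoly_sq p hp2 hz
  obtain ⟨r, hr, hB⟩ := exists_aeval_sineProdPoly_eq p hp2
  have h3 : ∃ ε : ℤ, (ε = 1 ∨ ε = -1) ∧ gaussSum (legendreChar p) ZMod.stdAddChar =
      ε * aeval (exp (2 * Real.pi * I / p)) (sineProdPoly p) := by
    rcases sq_eq_sq_iff_eq_or_eq_neg.1 (h1.trans h2.symm) with h | h
    · exact ⟨1, Or.inl rfl, by simpa using h⟩
    · exact ⟨-1, Or.inr rfl, by simpa using h⟩
  obtain ⟨ε, hε, h3⟩ := h3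
  -- The cyclotomic polynomial is the minimal polynomial of `ζ` over `ℤ`, so an equality at `ζ`
  -- becomes a divisibility that can be reduced modulo `p`.
  have h4 : cyclotomic p ℤ ∣ legendrePoly p - C ε * sineProdPoly p := by
    rw [cyclotomic_eq_minpoly hz hp.pos]
    refine minpoly.isIntegrallyClosed_dvd (hz.isIntegral hp.pos) ?_
    rw [map_sub, map_mul, aeval_legendrePoly, h3, aeval_C]
    simp
  have h5 := eq_legendreSym_neg_two_of_cyclotomic_dvd p hp2 ε hε h4
  have hr2 : r = √p := by
    have : (r : ℂ) ^ 2 = (p : ℝ) := by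
      rw [hB, mul_pow, ← pow_mul, mul_comm (p / 2), pow_mul, I_sq] at h2
      simpa using h2
    rw [← Real.sqrt_sq hr.le]
    congr 1
    exact_mod_cast this
  rw [h3, hB, h5, legendreSym.at_neg_two hp2, ZMod.χ₈'_nat_eq_if_mod_eight, hr2]
  have h8 : p % 8 = 1 ∨ p % 8 = 3 ∨ p % 8 = 5 ∨ p % 8 = 7 := by omega
  have hI : I ^ (p / 2) = I ^ (p / 2 % 4) := by
    conv_lhs => rw [← Nat.mod_add_div (p / 2) 4, pow_add, pow_mul, I_pow_four, one_pow, mul_one]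
  rw [hI]
  rcases h8 with h | h | h | h
  · rw [show p / 2 % 4 = 0 by omega, show p % 4 = 1 by omega, hp1, h]
    simp
  · rw [show p / 2 % 4 = 1 by omega, show p % 4 = 3 by omega, hp1, h]
    simp
  · rw [show p / 2 % 4 = 2 by omega, show p % 4 = 1 by omega, hp1, h]
    simp
  · rw [show p / 2 % 4 = 3 by omega, show p % 4 = 3 by omega, hp1, h]
    simp

theorem sum_legendreChar_mul_exp (p : ℕ) [Fact p.Prime] (hp2 : p ≠ 2) (n : ℤ) :
    ∑ a : ZMod p, legendreChar p a * exp (2 * Real.pi * n * (a.val / p) * I) =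
      legendreSym p n * gaussSum (legendreChar p) ZMod.stdAddChar := by
  have hq := (quadraticChar_isQuadratic (ZMod p)).comp (Int.castRingHom ℂ)
  have key : gaussSum (legendreChar p) (AddChar.mulShift ZMod.stdAddChar (n : ZMod p)) =
      legendreChar p (n : ZMod p) * gaussSum (legendreChar p) ZMod.stdAddChar := by
    -- If `p ∣ n`, both sides vanish; otherwise `n` is a unit and `a` can be rescaled by it.
    by_cases hn : (n : ZMod p) = 0
    · rw [hn, AddChar.mulShift_zero, gaussSum_one_right (legendreChar_ne_one p hp2),
        MulChar.map_zero, zero_mul]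
    · have := gaussSum_mulShift_eq (legendreChar p) ZMod.stdAddChar (Units.mk0 _ hn)
      rwa [show (legendreChar p)⁻¹ = legendreChar p from hq.inv] at this
  rw [← legendreChar_apply, ← key, gaussSum]
  refine Finset.sum_congr rfl fun a _ ↦ ?_
  have := ZMod.stdAddChar_coe (N := p) (n * a.val)
  push_cast [ZMod.natCast_zmod_val] at this
  rw [AddChar.mulShift_apply, this]
  congr 2
  ring

theorem sum_quadraticChar_mul_cos (p : ℕ) [Fact p.Prime] (hp : p % 4 = 1) (n : ℤ) :
    ∑ a : ZMod p, (quadraticChar (ZMod p) a : ℝ) * Real.cos (2 * Real.pi * n * (a.val / p)) =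
      legendreSym p n * √p := by
  have h := sum_legendreChar_mul_exp p (by rintro rfl; omega) n
  rw [gaussSum_legendreChar p (by rintro rfl; omega), if_pos hp] at h
  have h2 := congrArg re h
  rw [re_sum] at h2
  convert! h2 using 1
  · refine Finset.sum_congr rfl fun a _ ↦ ?_
    rw [show legendreChar p a = (((quadraticChar (ZMod p) a : ℤ) : ℝ) : ℂ) by norm_cast,
      re_ofReal_mul, ← exp_ofReal_mul_I_re]
    push_cast
    rfl
  · norm_cast

theorem sum_quadraticChar_mul_sin_eq_zero (p : ℕ) [Fact p.Prime] (hp : p % 4 = 1) (n : ℤ) :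
    ∑ a : ZMod p, (quadraticChar (ZMod p) a : ℝ) * Real.sin (2 * Real.pi * n * (a.val / p)) =
      0 := by
  have h := sum_legendreChar_mul_exp p (by rintro rfl; omega) n
  rw [gaussSum_legendreChar p (by rintro rfl; omega), if_pos hp] at h
  have h2 := congrArg im h
  rw [im_sum] at h2
  convert! h2 using 1
  · refine Finset.sum_congr rfl fun a _ ↦ ?_
    rw [show legendreChar p a = (((quadraticChar (ZMod p) a : ℤ) : ℝ) : ℂ) by norm_cast,
      im_ofReal_mul, ← exp_ofReal_mul_I_im]
    push_cast
    rfl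
  · simp

theorem sum_quadraticChar_mul_sin (p : ℕ) [Fact p.Prime] (hp : p % 4 = 3) (n : ℤ) :
    ∑ a : ZMod p, (quadraticChar (ZMod p) a : ℝ) * Real.sin (2 * Real.pi * n * (a.val / p)) =
      legendreSym p n * √p := by
  have h := sum_legendreChar_mul_exp p (by rintro rfl; omega) n
  rw [gaussSum_legendreChar p (by rintro rfl; omega), if_neg (by omega)] at h
  have h2 := congrArg im h
  rw [im_sum] at h2
  convert! h2 using 1
  · refine Finset.sum_congr rfl fun a _ ↦ ?_
    rw [show legendreChar p a = (((quadraticChar (ZMod p) a : ℤ) : ℝ) : ℂ) by norm_cast,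
      im_ofReal_mul, ← exp_ofReal_mul_I_im]
    push_cast
    rfl
  · rw [mul_left_comm, show ((legendreSym p n : ℂ) * (√p : ℂ)) =
      ((legendreSym p n * √p : ℝ) : ℂ) by push_cast; rfl, I_mul_im, ofReal_re]

end GaussSumValue

/-! ### Dirichlet series at `s = 1`: convergence, value and positivity -/

section DirichletSeriesAtOne

theorem sum_range_mul_eq_sum_range_sub (g w : ℕ → ℝ) (M : ℕ) :
    ∑ k ∈ Finset.range M, g k * w k = (∑ k ∈ Finset.range M, g k) * w M +
      ∑ k ∈ Finset.range M, (∑ i ∈ Finset.range (k + 1), g i) * (w k - w (k + 1)) := by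
  induction M with
  | zero => simp
  | succ M ih =>
    rw [Finset.sum_range_succ, ih, Finset.sum_range_succ g M,
      Finset.sum_range_succ (fun k ↦ (∑ i ∈ Finset.range (k + 1), g i) * (w k - w (k + 1))) M,
      Finset.sum_range_succ g M]
    ring

/-- The bound is uniform in `s` and summable over integers `x`, as dominated convergence at `s → 1`
requires. -/
theorem abs_rpow_neg_sub_rpow_neg_le {x s : ℝ} (hx : 1 ≤ x) (hs1 : 1 ≤ s) (hs2 : s ≤ 2) :
    |x ^ (-s) - (x + 1) ^ (-s)| ≤ 2 / x ^ 2 := by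
  have hx0 : 0 < x := by linarith
  have hr0 : 0 < x / (x + 1) := by positivity
  have hr1 : x / (x + 1) ≤ 1 := by rw [div_le_one (by positivity)]; linarith
  have h1 : (x + 1) ^ (-s) = x ^ (-s) * (x / (x + 1)) ^ s := by
    rw [Real.div_rpow hx0.le (by positivity), Real.rpow_neg hx0.le, Real.rpow_neg (by positivity)]
    have := (Real.rpow_pos_of_pos hx0 s).ne'
    field_simp
  have h2 : (x / (x + 1)) ^ (2 : ℝ) ≤ (x / (x + 1)) ^ s :=
    Real.rpow_le_rpow_of_exponent_ge hr0 hr1 hs2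
  have h3 : (x / (x + 1)) ^ s ≤ 1 := Real.rpow_le_one hr0.le hr1 (by linarith)
  have h4 : x ^ (-s) ≤ x ^ (-1 : ℝ) := Real.rpow_le_rpow_of_exponent_le hx (by linarith)
  rw [Real.rpow_neg_one] at h4
  rw [Real.rpow_two] at h2
  have h5 : 0 ≤ x ^ (-s) := Real.rpow_nonneg hx0.le _
  rw [h1, ← mul_one_sub, abs_of_nonneg (mul_nonneg h5 (by linarith))]
  calc x ^ (-s) * (1 - (x / (x + 1)) ^ s) ≤ x⁻¹ * (1 - (x / (x + 1)) ^ 2) := by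
        gcongr
    _ ≤ 2 / x ^ 2 := by
        rw [div_pow, one_sub_div (by positivity), inv_mul_eq_div, div_div,
          div_le_div_iff₀ (by positivity) (by positivity)]
        nlinarith [mul_pos hx0 hx0, mul_pos (mul_pos hx0 hx0) hx0]

/-- A Dirichlet series with bounded partial sums of coefficients, after summation by parts. -/
noncomputable def partsSeries (g : ℕ → ℝ) (s : ℝ) : ℝ :=
  ∑' k : ℕ, (∑ i ∈ Finset.range (k + 1), g i) *
    (((k + 1 : ℕ) : ℝ) ^ (-s) - ((k + 1 + 1 : ℕ) : ℝ) ^ (-s))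

theorem summable_partsSeries_bound (B : ℝ) :
    Summable fun k : ℕ ↦ B * (2 / ((k + 1 : ℕ) : ℝ) ^ 2) := by
  refine Summable.mul_left _ ?_
  simp_rw [div_eq_mul_inv]
  exact ((summable_nat_add_iff 1).2 (Real.summable_nat_pow_inv.2 one_lt_two)).mul_left 2

section

variable {g : ℕ → ℝ} {B : ℝ} (hB : ∀ n, |∑ i ∈ Finset.range n, g i| ≤ B)

include hB

theorem norm_partsSeries_term_le {s : ℝ} (hs1 : 1 ≤ s) (hs2 : s ≤ 2) (k : ℕ) :
    ‖(∑ i ∈ Finset.range (k + 1), g i) *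
      (((k + 1 : ℕ) : ℝ) ^ (-s) - ((k + 1 + 1 : ℕ) : ℝ) ^ (-s))‖ ≤
      B * (2 / ((k + 1 : ℕ) : ℝ) ^ 2) := by
  rw [norm_mul, Nat.cast_add_one (k + 1)]
  have h0 : 0 ≤ B := (abs_nonneg _).trans (hB 0)
  exact mul_le_mul (hB _) (abs_rpow_neg_sub_rpow_neg_le (by simp) hs1 hs2)
    (norm_nonneg _) h0

theorem tendsto_sum_mul_rpow_neg {s : ℝ} (hs1 : 1 ≤ s) (hs2 : s ≤ 2) :
    Tendsto (fun M ↦ ∑ k ∈ Finset.range M, g k * ((k + 1 : ℕ) : ℝ) ^ (-s)) atTop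
      (𝓝 (partsSeries g s)) := by
  have h1 : Tendsto (fun M : ℕ ↦ (∑ k ∈ Finset.range M, g k) * ((M + 1 : ℕ) : ℝ) ^ (-s)) atTop
      (𝓝 0) := by
    refine bdd_le_mul_tendsto_zero' B (Eventually.of_forall hB) ?_
    exact (tendsto_rpow_neg_atTop (by linarith)).comp
      (tendsto_natCast_atTop_atTop.comp (tendsto_add_atTop_nat 1))
  have h2 : Summable fun k : ℕ ↦ (∑ i ∈ Finset.range (k + 1), g i) *
      (((k + 1 : ℕ) : ℝ) ^ (-s) - ((k + 1 + 1 : ℕ) : ℝ) ^ (-s)) :=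
    Summable.of_norm_bounded (summable_partsSeries_bound B)
      (norm_partsSeries_term_le hB hs1 hs2)
  have h3 := h1.add h2.hasSum.tendsto_sum_nat
  rw [zero_add] at h3
  refine h3.congr fun M ↦ ?_
  rw [sum_range_mul_eq_sum_range_sub g (fun k ↦ ((k + 1 : ℕ) : ℝ) ^ (-s))]

theorem tendsto_partsSeries_one : Tendsto (partsSeries g) (𝓝[>] 1) (𝓝 (partsSeries g 1)) := by
  refine tendsto_tsum_of_dominated_convergence (summable_partsSeries_bound B) (fun k ↦ ?_) ?_
  · refine Tendsto.mono_left ?_ nhdsWithin_le_nhds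
    refine Tendsto.const_mul _ (Tendsto.sub ?_ ?_)
    · exact (Real.continuousAt_const_rpow (by positivity)).tendsto.comp continuous_neg.continuousAt
    · exact (Real.continuousAt_const_rpow (by positivity)).tendsto.comp continuous_neg.continuousAt
  · filter_upwards [Ioo_mem_nhdsGT (one_lt_two : (1 : ℝ) < 2)] with s hs k
    exact norm_partsSeries_term_le hB hs.1.le hs.2.le k

theorem tendsto_sum_div_partsSeries :
    Tendsto (fun M ↦ ∑ k ∈ Finset.range M, g k / ((k + 1 : ℕ) : ℝ)) atTop
      (𝓝 (partsSeries g 1)) := by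
  refine (tendsto_sum_mul_rpow_neg hB le_rfl one_le_two).congr fun M ↦ ?_
  simp_rw [Real.rpow_neg_one, div_eq_mul_inv]

end

theorem LFunction_ofReal_eq_partsSeries {N : ℕ} [NeZero N] (χ : DirichletCharacter ℂ N) {g : ℕ → ℝ}
    {B : ℝ} (hB : ∀ n, |∑ i ∈ Finset.range n, g i| ≤ B)
    (hg : ∀ n : ℕ, χ ((n + 1 : ℕ) : ZMod N) = (g n : ℂ)) {s : ℝ} (hs1 : 1 < s) (hs2 : s ≤ 2) :
    χ.LFunction s = (partsSeries g s : ℂ) := by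
  have hs1' : 1 < (s : ℂ).re := by simpa using hs1
  rw [χ.LFunction_eq_LSeries hs1']
  have h1 := (χ.LSeriesSummable_of_one_lt_re hs1').hasSum.tendsto_sum_nat.comp
    (tendsto_add_atTop_nat 1)
  have h2 := (Complex.continuous_ofReal.tendsto _).comp
    (tendsto_sum_mul_rpow_neg hB hs1.le hs2)
  refine tendsto_nhds_unique (h1.congr fun M ↦ ?_) h2
  simp only [Function.comp_apply]
  rw [Finset.sum_range_succ', LSeries.term_zero, add_zero, Complex.ofReal_sum]
  refine Finset.sum_congr rfl fun k _ ↦ ?_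
  rw [LSeries.term_of_ne_zero (by omega), hg, Real.rpow_neg (by positivity), Complex.ofReal_mul,
    Complex.ofReal_inv, Complex.ofReal_cpow (by positivity), div_eq_mul_inv, Complex.ofReal_natCast]

/-- The two sides agree for `1 < s ≤ 2` and both tend to their values at 1 from the right. -/
theorem LFunction_one_eq_partsSeries {N : ℕ} [NeZero N] {χ : DirichletCharacter ℂ N} (hχ : χ ≠ 1)
    {g : ℕ → ℝ} {B : ℝ} (hB : ∀ n, |∑ i ∈ Finset.range n, g i| ≤ B)
    (hg : ∀ n : ℕ, χ ((n + 1 : ℕ) : ZMod N) = (g n : ℂ)) :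
    χ.LFunction 1 = (partsSeries g 1 : ℂ) := by
  have h1 := (Complex.continuous_ofReal.tendsto _).comp (tendsto_partsSeries_one hB)
  have h2 : Tendsto (fun s : ℝ ↦ χ.LFunction s) (𝓝[>] 1) (𝓝 (χ.LFunction 1)) := by
    have : Continuous fun s : ℝ ↦ χ.LFunction s :=
      (DirichletCharacter.differentiable_LFunction hχ).continuous.comp Complex.continuous_ofReal
    simpa using (this.tendsto 1).mono_left nhdsWithin_le_nhds
  refine tendsto_nhds_unique (h2.congr' ?_) h1
  filter_upwards [Ioo_mem_nhdsGT (one_lt_two : (1 : ℝ) < 2)] with s hs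
  exact LFunction_ofReal_eq_partsSeries χ hB hg hs.1 hs.2.le

theorem LFunction_one_re_pos {N : ℕ} [NeZero N] {χ : DirichletCharacter ℂ N} (hχ : χ ≠ 1)
    (hre : ∀ a : ZMod N, (χ a).im = 0) {l : ℝ} (hl : χ.LFunction 1 = l) : 0 < l := by
  have hne := DirichletCharacter.LFunction_apply_one_ne_zero hχ
  rw [hl] at hne
  refine lt_of_le_of_ne ?_ (Ne.symm (by exact_mod_cast hne))
  have h2 : Tendsto (fun s : ℝ ↦ (χ.LFunction s).re) (𝓝[>] 1) (𝓝 l) := by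
    have : Continuous fun s : ℝ ↦ (χ.LFunction s).re :=
      Complex.continuous_re.comp
        ((DirichletCharacter.differentiable_LFunction hχ).continuous.comp Complex.continuous_ofReal)
    have h3 := this.tendsto 1
    simp only [Complex.ofReal_one, hl, Complex.ofReal_re] at h3
    exact h3.mono_left nhdsWithin_le_nhds
  refine ge_of_tendsto h2 ?_
  filter_upwards [self_mem_nhdsWithin] with s hs
  have hs1 : 1 < (s : ℂ).re := by simpa using hs
  have hs0 : 0 < s := zero_lt_one.trans hs
  rw [χ.LFunction_eq_LSeries hs1]
  refine ge_of_tendsto ((Complex.continuous_re.tendsto _).comp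
    (DirichletCharacter.LSeries_eulerProduct χ hs1)) (Eventually.of_forall fun n ↦ ?_)
  have key : ∀ p ∈ n.primesBelow, (1 - χ p * (p : ℂ) ^ (-(s : ℂ)))⁻¹ =
      (((1 - (χ p).re * (p : ℝ) ^ (-s))⁻¹ : ℝ) : ℂ) := by
    intro p _
    have : χ p = ((χ p).re : ℂ) := Complex.ext rfl (by simp [hre])
    rw [← Complex.ofReal_natCast p, ← Complex.ofReal_neg, ← Complex.ofReal_cpow (by positivity)]
    push_cast
    rw [← this]
  simp only [Function.comp_apply]
  rw [Finset.prod_congr rfl key, ← Complex.ofReal_prod, Complex.ofReal_re]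
  -- Each Euler factor is the inverse of `1 - χ(p) p^(-s) ≥ 0`, so `L(s, χ) ≥ 0` for `s > 1`;
  -- nonvanishing at 1 makes the limit positive.
  refine Finset.prod_nonneg fun p hp ↦ inv_nonneg.2 ?_
  have hp1 : (1 : ℝ) ≤ p := by exact_mod_cast (Nat.prime_of_mem_primesBelow hp).one_le
  have h4 : (p : ℝ) ^ (-s) ≤ 1 := Real.rpow_le_one_of_one_le_of_nonpos hp1 (by linarith)
  have h5 : 0 ≤ (p : ℝ) ^ (-s) := by positivity
  have h6 : (χ p).re ≤ 1 := (Complex.re_le_norm _).trans (χ.norm_le_one _)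
  nlinarith

end DirichletSeriesAtOne

/-! ### The Fourier series of the sawtooth -/

section SineSeries

/-- For `0 < x < 1` this is a polar form, from which the argument `πx - π/2` of the logarithm is
read off. -/
theorem one_sub_exp_eq (x : ℝ) : 1 - Complex.exp (2 * Real.pi * x * Complex.I) =
    ((2 * Real.sin (Real.pi * x) : ℝ) : ℂ) * (Complex.cos ((Real.pi * x - Real.pi / 2 : ℝ) : ℂ) +
      Complex.sin ((Real.pi * x - Real.pi / 2 : ℝ) : ℂ) * Complex.I) := by
  rw [show (2 * Real.pi * x * Complex.I : ℂ) = ((2 * (Real.pi * x) : ℝ) : ℂ) * Complex.I by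
    push_cast; ring, Complex.exp_mul_I, ← Complex.ofReal_cos, ← Complex.ofReal_sin,
    ← Complex.ofReal_cos, ← Complex.ofReal_sin, Real.cos_sub_pi_div_two, Real.sin_sub_pi_div_two,
    Real.sin_two_mul, Real.cos_two_mul']
  have h := Real.sin_sq_add_cos_sq (Real.pi * x)
  generalize Real.sin (Real.pi * x) = s at *
  generalize Real.cos (Real.pi * x) = c at *
  apply Complex.ext
  · rw [Complex.re_ofReal_mul]
    simp [-Complex.ofReal_sub, -Complex.ofReal_mul, -Complex.ofReal_pow]
    linarith
  · rw [Complex.im_ofReal_mul]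
    simp [-Complex.ofReal_sub, -Complex.ofReal_mul, -Complex.ofReal_pow]

theorem exp_two_pi_mul_ne_one {x : ℝ} (hx0 : 0 < x) (hx1 : x < 1) :
    Complex.exp (2 * Real.pi * x * Complex.I) ≠ 1 := by
  have hs : 0 < Real.sin (Real.pi * x) :=
    Real.sin_pos_of_pos_of_lt_pi (by positivity) (by nlinarith [Real.pi_pos])
  intro h
  have h2 := congrArg Complex.re (one_sub_exp_eq x)
  rw [h, Complex.re_ofReal_mul, ← Complex.ofReal_cos, ← Complex.ofReal_sin,
    Real.cos_sub_pi_div_two, Complex.add_re, Complex.ofReal_re, Complex.re_ofReal_mul] at h2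
  have h3 : 0 < 2 * Real.sin (Real.pi * x) * Real.sin (Real.pi * x) := by positivity
  simp only [sub_self, Complex.zero_re, Complex.I_re, mul_zero, add_zero] at h2
  exact h3.ne h2

theorem im_neg_log_one_sub_exp {x : ℝ} (hx0 : 0 < x) (hx1 : x < 1) :
    (-Complex.log (1 - Complex.exp (2 * Real.pi * x * Complex.I))).im =
      Real.pi * (1 / 2 - x) := by
  have hs : 0 < Real.sin (Real.pi * x) :=
    Real.sin_pos_of_pos_of_lt_pi (by positivity) (by nlinarith [Real.pi_pos])
  rw [one_sub_exp_eq, Complex.neg_im, Complex.log_im,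
    Complex.arg_mul_cos_add_sin_mul_I (by positivity)]
  · ring
  · constructor <;> nlinarith [Real.pi_pos]

theorem exists_abs_sum_sin_le {x : ℝ} (hx0 : 0 < x) (hx1 : x < 1) :
    ∃ B, ∀ n, |∑ k ∈ Finset.range n, Real.sin (2 * Real.pi * x * (k + 1 : ℕ))| ≤ B := by
  set z := Complex.exp (2 * Real.pi * x * Complex.I) with hz
  have hz1 : z ≠ 1 := exp_two_pi_mul_ne_one hx0 hx1
  have hzn : ‖z‖ = 1 := by
    rw [hz, show (2 * Real.pi * x * Complex.I : ℂ) = ((2 * Real.pi * x : ℝ) : ℂ) * Complex.I by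
      push_cast; ring]
    exact Complex.norm_exp_ofReal_mul_I _
  have him (k : ℕ) : Real.sin (2 * Real.pi * x * k) = (z ^ k).im := by
    rw [hz, ← Complex.exp_nat_mul, show (k * (2 * Real.pi * x * Complex.I) : ℂ) =
      ((2 * Real.pi * x * k : ℝ) : ℂ) * Complex.I by push_cast; ring,
      Complex.exp_ofReal_mul_I_im]
  refine ⟨2 / ‖z - 1‖, fun n ↦ ?_⟩
  simp_rw [him, ← Complex.im_sum]
  refine (Complex.abs_im_le_norm _).trans ?_
  simp_rw [pow_succ']
  rw [← Finset.mul_sum, geom_sum_eq hz1, norm_mul, hzn, one_mul, norm_div]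
  gcongr
  refine (norm_sub_le _ _).trans ?_
  rw [norm_pow, hzn]
  norm_num

theorem tendsto_sum_sin_div {x : ℝ} (hx0 : 0 < x) (hx1 : x < 1) :
    Tendsto (fun M ↦ ∑ k ∈ Finset.range M,
      Real.sin (2 * Real.pi * x * (k + 1 : ℕ)) / ((k + 1 : ℕ) : ℝ)) atTop
      (𝓝 (Real.pi * (1 / 2 - x))) := by
  obtain ⟨B, hB⟩ := exists_abs_sum_sin_le hx0 hx1
  have h1 := tendsto_sum_div_partsSeries hB
  have h2 := Real.tendsto_tsum_powerSeries_nhdsWithin_lt h1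
  set z := Complex.exp (2 * Real.pi * x * Complex.I) with hz
  have hzn : ‖z‖ = 1 := by
    rw [hz, show (2 * Real.pi * x * Complex.I : ℂ) = ((2 * Real.pi * x : ℝ) : ℂ) * Complex.I by
      push_cast; ring]
    exact Complex.norm_exp_ofReal_mul_I _
  have him (k : ℕ) : Real.sin (2 * Real.pi * x * k) = (z ^ k).im := by
    rw [hz, ← Complex.exp_nat_mul, show (k * (2 * Real.pi * x * Complex.I) : ℂ) =
      ((2 * Real.pi * x * k : ℝ) : ℂ) * Complex.I by push_cast; ring,
      Complex.exp_ofReal_mul_I_im]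
  have hslit : 1 - z ∈ Complex.slitPlane := by
    have hs : 0 < Real.sin (Real.pi * x) :=
      Real.sin_pos_of_pos_of_lt_pi (by positivity) (by nlinarith [Real.pi_pos])
    refine Or.inl ?_
    rw [hz, one_sub_exp_eq, Complex.re_ofReal_mul, ← Complex.ofReal_cos, ← Complex.ofReal_sin,
      Real.cos_sub_pi_div_two, Complex.add_re, Complex.ofReal_re, Complex.re_ofReal_mul,
      Complex.I_re, mul_zero, add_zero]
    positivity
  -- Abel's limit theorem identifies the sum. The factor `r⁻¹` compensates for the index shift: the
  -- coefficient of `r^k` is the term of index `k + 1`.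
  have h3 : Tendsto (fun r : ℝ ↦ r⁻¹ * (-Complex.log (1 - r * z)).im) (𝓝[<] 1)
      (𝓝 (Real.pi * (1 / 2 - x))) := by
    rw [← im_neg_log_one_sub_exp hx0 hx1, ← hz]
    have h4 : ContinuousAt (fun r : ℝ ↦ r⁻¹ * (-Complex.log (1 - r * z)).im) 1 := by
      refine (continuousAt_inv₀ one_ne_zero).mul
        (Complex.continuous_im.continuousAt.comp (ContinuousAt.neg ?_))
      refine ContinuousAt.clog (by fun_prop) (by simpa using hslit)
    simpa using h4.tendsto.mono_left nhdsWithin_le_nhds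
  have h5 := tendsto_nhds_unique (h2.congr' ?_) h3
  · rwa [h5] at h1
  filter_upwards [Ioo_mem_nhdsLT (zero_lt_one : (0 : ℝ) < 1)] with r hr
  have hrz : ‖(r : ℂ) * z‖ < 1 := by
    rw [norm_mul, hzn, mul_one, Complex.norm_real, Real.norm_of_nonneg hr.1.le]
    exact hr.2
  have h6 := ((Complex.hasSum_iff _ _).1 (Complex.hasSum_taylorSeries_neg_log' hrz)).2
  rw [← h6.tsum_eq, ← tsum_mul_left]
  refine tsum_congr fun k ↦ ?_
  rw [him, mul_pow, ← Complex.ofReal_pow, mul_div_assoc, Complex.im_ofReal_mul,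
    ← Nat.cast_add_one, Complex.div_natCast_im, pow_succ']
  have := hr.1.ne'
  field_simp
  ring

theorem sin_two_pi_mul_fract (x : ℝ) (n : ℕ) :
    Real.sin (2 * Real.pi * Int.fract x * n) = Real.sin (2 * Real.pi * x * n) := by
  rw [← Int.self_sub_floor, ← Real.sin_sub_int_mul_two_pi (2 * Real.pi * x * n) (⌊x⌋ * n)]
  congr 1
  push_cast
  ring

/-- If a nonprincipal character is a finite combination of sine waves, then `∑ χ(n) / n` converges
to `L(1, χ)`, which is given by the sawtooth function at the frequencies. -/
theorem LFunction_one_of_eq_sum_sin {N : ℕ} [NeZero N] {χ : DirichletCharacter ℂ N} (hχ : χ ≠ 1)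
    {ι : Type*} (J : Finset ι) (c x : ι → ℝ) (hx : ∀ j ∈ J, c j ≠ 0 → Int.fract (x j) ≠ 0)
    (hχs : ∀ n : ℕ, χ (n : ZMod N) =
      ((∑ j ∈ J, c j * Real.sin (2 * Real.pi * x j * n) : ℝ) : ℂ)) :
    Tendsto (fun M : ℕ ↦ ∑ n ∈ Finset.Icc 1 M, χ (n : ZMod N) / (n : ℂ)) atTop
      (𝓝 (χ.LFunction 1)) ∧
    χ.LFunction 1 = ((∑ j ∈ J, c j * (Real.pi * (1 / 2 - Int.fract (x j))) : ℝ) : ℂ) := by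
  set g : ℕ → ℝ := fun k ↦ ∑ j ∈ J, c j * Real.sin (2 * Real.pi * x j * (k + 1 : ℕ)) with hg
  have hfr {j : ι} (hj : j ∈ J) (hc : c j ≠ 0) : 0 < Int.fract (x j) :=
    lt_of_le_of_ne (Int.fract_nonneg _) (hx j hj hc).symm
  -- Only frequencies with nonzero coefficient count: at an integer frequency the sine series is 0
  -- while the sawtooth expression is `π/2`. This occurs for `a = 0` among the frequencies `a / p`.
  have hex : ∀ j, ∃ B, j ∈ J → c j ≠ 0 → ∀ n,
      |∑ k ∈ Finset.range n, Real.sin (2 * Real.pi * x j * (k + 1 : ℕ))| ≤ B := by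
    intro j
    by_cases h : j ∈ J ∧ c j ≠ 0
    · obtain ⟨B, hB⟩ := exists_abs_sum_sin_le (hfr h.1 h.2) (Int.fract_lt_one (x j))
      simp_rw [sin_two_pi_mul_fract] at hB
      exact ⟨B, fun _ _ ↦ hB⟩
    · exact ⟨0, fun h1 h2 ↦ absurd ⟨h1, h2⟩ h⟩
  choose B hB using hex
  have hgB : ∀ n, |∑ i ∈ Finset.range n, g i| ≤ ∑ j ∈ J, |c j| * B j := by
    intro n
    rw [hg, Finset.sum_comm]
    refine (Finset.abs_sum_le_sum_abs _ _).trans (Finset.sum_le_sum fun j hj ↦ ?_)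
    rw [← Finset.mul_sum, abs_mul]
    by_cases hc : c j = 0
    · simp [hc]
    · exact mul_le_mul_of_nonneg_left (hB j hj hc n) (abs_nonneg _)
  have hχg (n : ℕ) : χ ((n + 1 : ℕ) : ZMod N) = (g n : ℂ) := hχs (n + 1)
  have h1 := tendsto_sum_div_partsSeries hgB
  have hL := LFunction_one_eq_partsSeries hχ hgB hχg
  constructor
  · rw [hL]
    refine ((Complex.continuous_ofReal.tendsto _).comp h1).congr fun M ↦ ?_
    simp only [Function.comp_apply]
    rw [Complex.ofReal_sum, Finset.range_eq_Ico, ← Finset.Ico_add_one_right_eq_Icc,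
      ← Finset.sum_Ico_add' (fun n : ℕ ↦ χ (n : ZMod N) / (n : ℂ)) 0 M 1]
    refine Finset.sum_congr rfl fun k _ ↦ ?_
    rw [hχg]
    push_cast
    rfl
  · rw [hL]
    congr 1
    refine tendsto_nhds_unique h1 ?_
    have h2 : Tendsto (fun M ↦ ∑ j ∈ J, c j * ∑ k ∈ Finset.range M,
        Real.sin (2 * Real.pi * x j * (k + 1 : ℕ)) / ((k + 1 : ℕ) : ℝ)) atTop
        (𝓝 (∑ j ∈ J, c j * (Real.pi * (1 / 2 - Int.fract (x j))))) := by
      refine tendsto_finsetSum _ fun j hj ↦ ?_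
      by_cases hc : c j = 0
      · simp [hc]
      · have h3 := tendsto_sum_sin_div (hfr hj hc) (Int.fract_lt_one (x j))
        simp_rw [sin_two_pi_mul_fract] at h3
        exact h3.const_mul _
    refine h2.congr fun M ↦ ?_
    simp_rw [hg, Finset.sum_div, Finset.mul_sum]
    rw [Finset.sum_comm]
    refine Finset.sum_congr rfl fun k _ ↦ Finset.sum_congr rfl fun j _ ↦ ?_
    ring

end SineSeries

/-! ### Sawtooth sums as quadratic excesses -/

section QuadraticExcess

theorem quadraticExcess_zero_div_eq_sum (p : ℕ) [Fact p.Prime] (k : ℕ) (hk : 0 < k) :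
    (quadraticExcess p 0 (p / k) : ℝ) =
      ∑ a : ZMod p, (quadraticChar (ZMod p) a : ℝ) * if k * a.val < p then 1 else 0 := by
  have h1 : ∑ a : ZMod p, (quadraticChar (ZMod p) a : ℝ) * (if k * a.val < p then 1 else 0) =
      ∑ j ∈ Finset.range p, (legendreSym p j : ℝ) * if k * j < p then 1 else 0 := by
    rw [← sum_zmod_val_eq_sum_range]
    refine Finset.sum_congr rfl fun a _ ↦ ?_
    rw [legendreSym, Int.cast_natCast, ZMod.natCast_zmod_val]
  have h2 : ∑ j ∈ Finset.range p, (legendreSym p j : ℝ) * (if k * j < p then 1 else 0) =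
      ∑ j ∈ Finset.range p with 0 < j ∧ k * j < p, (legendreSym p j : ℝ) := by
    rw [Finset.sum_filter]
    refine Finset.sum_congr rfl fun j _ ↦ ?_
    rcases j.eq_zero_or_pos with rfl | hj
    · simp [legendreSym.at_zero]
    · simp [hj]
  rw [h1, h2, quadraticExcess, Int.cast_sum]
  have hmem (n : ℤ) : n ∈ Finset.Ioo ⌊(0 : ℝ)⌋ ⌈(p / k : ℝ)⌉ ↔ 0 < n ∧ k * n < p := by
    rw [mem_Ioo_floor_ceil_iff, lt_div_iff₀ (by exact_mod_cast hk), mul_comm]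
    norm_cast
  refine Finset.sum_nbij' Int.toNat (fun j ↦ (j : ℤ)) ?_ ?_ ?_ ?_ ?_
  · intro n hn
    obtain ⟨h0, h1⟩ := (hmem n).1 hn
    lift n to ℕ using h0.le
    norm_cast at h0 h1
    simp only [Int.toNat_natCast, Finset.mem_filter, Finset.mem_range]
    exact ⟨lt_of_le_of_lt (Nat.le_mul_of_pos_left n hk) h1, h0, h1⟩
  · intro j hj
    rw [Finset.mem_filter] at hj
    rw [hmem]
    exact_mod_cast hj.2
  · intro n hn
    exact Int.toNat_of_nonneg ((hmem n).1 hn).1.le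
  · simp
  · intro n hn
    rw [Int.toNat_of_nonneg ((hmem n).1 hn).1.le]

theorem sum_quadraticChar_mul_comp_mul (p : ℕ) [Fact p.Prime] {c : ZMod p} (hc : c ≠ 0)
    (F : ZMod p → ℝ) : ∑ a : ZMod p, (quadraticChar (ZMod p) a : ℝ) * F (c * a) =
      quadraticChar (ZMod p) c * ∑ a : ZMod p, (quadraticChar (ZMod p) a : ℝ) * F a := by
  rw [← Equiv.sum_comp (Equiv.mulLeft₀ c hc) (fun a ↦ (quadraticChar (ZMod p) a : ℝ) * F a),
    Finset.mul_sum]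
  refine Finset.sum_congr rfl fun a _ ↦ ?_
  have h : ((quadraticChar (ZMod p) c : ℤ) : ℝ) * quadraticChar (ZMod p) c = 1 := by
    rw [← sq]
    exact_mod_cast quadraticChar_sq_one hc
  simp only [Equiv.mulLeft₀_apply, map_mul, Int.cast_mul]
  linear_combination -((quadraticChar (ZMod p) a : ℝ) * F (c * a)) * h

theorem sum_quadraticChar_mul_congr (p : ℕ) [Fact p.Prime] {F G : ZMod p → ℝ}
    (h : ∀ a, a ≠ 0 → F a = G a) :
    ∑ a : ZMod p, (quadraticChar (ZMod p) a : ℝ) * F a =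
      ∑ a : ZMod p, (quadraticChar (ZMod p) a : ℝ) * G a := by
  refine Finset.sum_congr rfl fun a _ ↦ ?_
  by_cases ha : a = 0
  · simp [ha]
  · rw [h a ha]

theorem quadraticChar_neg_one_eq (p : ℕ) [Fact p.Prime] (hp2 : p ≠ 2) :
    quadraticChar (ZMod p) (-1) = if p % 4 = 1 then 1 else -1 := by
  have h := legendreSym.at_neg_one hp2
  rw [legendreSym, ZMod.χ₄_nat_eq_if_mod_four,
    if_neg (by have := (Fact.out : p.Prime).eq_two_or_odd; omega)] at h
  simpa using h

theorem sawtooth_mul_eq (p k : ℕ) [NeZero p] (a : ZMod p) :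
    k * (1 / 2 - (a.val : ℝ) / p) - (1 / 2 - (((k : ZMod p) * a).val : ℝ) / p) =
      (k - 1) / 2 - (k * a.val / p : ℕ) := by
  have hp : (p : ℝ) ≠ 0 := by exact_mod_cast NeZero.ne p
  have h1 : ((k : ZMod p) * a).val = k * a.val % p := by
    rw [← ZMod.val_natCast, Nat.cast_mul, ZMod.natCast_zmod_val]
  have h2 : ((k * a.val % p : ℕ) : ℝ) + p * (k * a.val / p : ℕ) = k * a.val := by
    exact_mod_cast Nat.mod_add_div (k * a.val) p
  rw [h1, eq_sub_of_add_eq h2]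
  field_simp
  ring

/-- The factor relating the sawtooth sum and `q(0, p/2)` or `q(0, p/3)`. -/
theorem sub_mul_sum_sawtooth (p : ℕ) [Fact p.Prime] (hp : p % 4 = 3) (k : ℕ) (hk : k = 2 ∨ k = 3)
    (hkp : ¬ p ∣ k) :
    (k - legendreSym p k) * ∑ a : ZMod p, (quadraticChar (ZMod p) a : ℝ) *
      (1 / 2 - (a.val : ℝ) / p) = (k - 1) * quadraticExcess p 0 (p / k) := by
  have hp0 : p.Prime := Fact.out
  have hk0 : (k : ZMod p) ≠ 0 := by rwa [Ne, ZMod.natCast_eq_zero_iff]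
  have h1 := sum_quadraticChar_mul_comp_mul p hk0 fun a ↦ 1 / 2 - (a.val : ℝ) / p
  have h2 := sum_quadraticChar_mul_comp_mul p (c := -1) (by simp)
    fun a ↦ if k * a.val < p then (1 : ℝ) else 0
  rw [quadraticChar_neg_one_eq p (by rintro rfl; omega), if_neg (by omega)] at h2
  have h3 : ∑ a : ZMod p, (quadraticChar (ZMod p) a : ℝ) *
      -- The left factor is `(k - 1)/2 - ⌊ka/p⌋`. For `k = 2, 3` it is nonzero only on the first and
      -- last intervals of length `p/k`, with opposite signs; since `χ_p` is odd, the two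
      -- contributions add up.
      (k * (1 / 2 - (a.val : ℝ) / p) - (1 / 2 - (((k : ZMod p) * a).val : ℝ) / p)) =
      ∑ a : ZMod p, (quadraticChar (ZMod p) a : ℝ) * ((k - 1) / 2 *
        ((if k * a.val < p then (1 : ℝ) else 0) - if k * (-1 * a).val < p then 1 else 0)) := by
    refine sum_quadraticChar_mul_congr p fun a ha ↦ ?_
    have hv : (-1 * a).val = p - a.val := by
      have : NeZero a := ⟨ha⟩
      rw [neg_one_mul, ZMod.val_neg_of_ne_zero]
    have hv0 : 0 < a.val := Nat.pos_of_ne_zero (by rwa [Ne, ZMod.val_eq_zero])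
    have hvp : a.val < p := a.val_lt
    have hnd : ¬ p ∣ k * a.val := by
      rw [hp0.dvd_mul]
      exact not_or.2 ⟨hkp, Nat.not_dvd_of_pos_of_lt hv0 hvp⟩
    rw [sawtooth_mul_eq, hv]
    generalize a.val = v at *
    rcases hk with rfl | rfl
    · rcases lt_or_ge (2 * v) p with h | h
      · rw [Nat.div_eq_of_lt h, if_pos h, if_neg (by omega)]
        norm_num
      · have : 2 * v ≠ p := by rintro rfl; exact hnd dvd_rfl
        rw [show 2 * v / p = 1 from Nat.div_eq_of_lt_le (by omega) (by omega),
          if_neg (by omega), if_pos (by omega)]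
        norm_num
    · have hne1 : 3 * v ≠ p := by rintro rfl; exact hnd dvd_rfl
      have hne2 : 3 * v ≠ 2 * p := fun h ↦ hnd (h ▸ dvd_mul_left p 2)
      rcases lt_or_ge (3 * v) p with h | h
      · rw [Nat.div_eq_of_lt h, if_pos h, if_neg (by omega)]
        norm_num
      rcases lt_or_ge (3 * v) (2 * p) with h' | h'
      · rw [show 3 * v / p = 1 from Nat.div_eq_of_lt_le (by omega) (by omega),
          if_neg (by omega), if_neg (by omega)]
        norm_num
      · rw [show 3 * v / p = 2 from Nat.div_eq_of_lt_le (by omega) (by omega),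
          if_neg (by omega), if_pos (by omega)]
        norm_num
  simp only [mul_sub, mul_left_comm _ (((k : ℝ) - 1) / 2),
    mul_left_comm _ (k : ℝ), Finset.sum_sub_distrib, ← Finset.mul_sum] at h1 h2 h3 ⊢
  have hkq : ((quadraticChar (ZMod p) (k : ZMod p) : ℤ) : ℝ) = legendreSym p k := by
    rw [legendreSym, Int.cast_natCast]
  rw [quadraticExcess_zero_div_eq_sum p k (by omega)]
  rw [hkq] at h1
  push_cast at h2
  linear_combination h3 + h1 - ((k : ℝ) - 1) / 2 * h2

theorem sum_quadraticChar_eq_zero (p : ℕ) [Fact p.Prime] (hp2 : p ≠ 2) :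
    ∑ a : ZMod p, (quadraticChar (ZMod p) a : ℝ) = 0 := by
  exact_mod_cast quadraticChar_sum_zero (F := ZMod p) (by rwa [ZMod.ringChar_zmod_n])

/-- The sum `1/k + v/p` lies in `(0, 2)` and exceeds 1 exactly when `k(p - v) < p`; `hne` excludes
the value 1. -/
theorem fract_inv_add_div {p k v : ℕ} (hk : 1 < k) (hp : 0 < p) (hvp : v < p)
    (hne : k * (p - v) ≠ p) :
    Int.fract (1 / (k : ℝ) + v / p) =
      1 / k + v / p - (if k * (p - v) < p then 1 else 0) ∧ Int.fract (1 / (k : ℝ) + v / p) ≠ 0 := by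
  have hkR : (1 : ℝ) < k := by exact_mod_cast hk
  have hpR : (0 : ℝ) < p := by exact_mod_cast hp
  have hvR : (v : ℝ) < p := by exact_mod_cast hvp
  have hk1 : 1 / (k : ℝ) < 1 := by rw [div_lt_one (by linarith)]; exact hkR
  have hk0 : 0 < 1 / (k : ℝ) := by positivity
  have hv1 : (v : ℝ) / p < 1 := by rw [div_lt_one hpR]; exact hvR
  have hv0 : 0 ≤ (v : ℝ) / p := by positivity
  have heq : 1 / (k : ℝ) + v / p - 1 = (p - k * (p - v)) / (k * p) := by
    field_simp
    ring
  have hcast : ((p - v : ℕ) : ℝ) = p - v := Nat.cast_sub hvp.le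
  rcases lt_or_gt_of_ne hne with h | h
  · have h' : (k : ℝ) * (p - v) < p := by rw [← hcast]; exact_mod_cast h
    have h3 : 0 < 1 / (k : ℝ) + v / p - 1 := by
      rw [heq]
      exact div_pos (by linarith) (by positivity)
    have h4 : Int.fract (1 / (k : ℝ) + v / p) = 1 / k + v / p - 1 :=
      Int.fract_eq_iff.2 ⟨h3.le, by linarith, 1, by push_cast; ring⟩
    rw [if_pos h, h4]
    exact ⟨rfl, h3.ne'⟩
  · have h' : (p : ℝ) < k * (p - v) := by rw [← hcast]; exact_mod_cast h
    have h3 : 1 / (k : ℝ) + v / p - 1 < 0 := by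
      rw [heq]
      exact div_neg_of_neg_of_pos (by linarith) (by positivity)
    have h4 : Int.fract (1 / (k : ℝ) + v / p) = 1 / k + v / p :=
      Int.fract_eq_iff.2 ⟨by linarith, by linarith, 0, by push_cast; ring⟩
    rw [if_neg (by omega), h4, sub_zero]
    exact ⟨rfl, by linarith⟩

theorem mul_sub_val_ne {p k : ℕ} [Fact p.Prime] (hkp : ¬ p ∣ k) {a : ZMod p} (ha : a ≠ 0) :
    k * (p - a.val) ≠ p := by
  intro h
  have hv0 : 0 < a.val := Nat.pos_of_ne_zero (by rwa [Ne, ZMod.val_eq_zero])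
  have hvp : a.val < p := a.val_lt
  have hd : p ∣ k * (p - a.val) := ⟨1, by omega⟩
  rcases (Fact.out : p.Prime).dvd_mul.1 hd with h1 | h1
  · exact hkp h1
  · exact Nat.not_dvd_of_pos_of_lt (by omega) (by omega) h1

theorem sum_quadraticChar_mul_sawtooth_shift (p : ℕ) [Fact p.Prime] (hp : p % 4 = 1) (k : ℕ)
    (hk : 1 < k) (hkp : ¬ p ∣ k) :
    ∑ a : ZMod p, (quadraticChar (ZMod p) a : ℝ) * (1 / 2 - Int.fract (1 / (k : ℝ) + a.val / p)) =
      quadraticExcess p 0 (p / k) := by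
  have hp0 : p.Prime := Fact.out
  have hpR : (p : ℝ) ≠ 0 := by exact_mod_cast hp0.ne_zero
  have hp2 : p ≠ 2 := by rintro rfl; omega
  have hval {a : ZMod p} (ha : a ≠ 0) : (-1 * a).val = p - a.val := by
    have : NeZero a := ⟨ha⟩
    rw [neg_one_mul, ZMod.val_neg_of_ne_zero]
  have h1 := sum_quadraticChar_mul_comp_mul p (c := -1) (by simp)
    fun a ↦ if k * a.val < p then (1 : ℝ) else 0
  have h2 := sum_quadraticChar_mul_comp_mul p (c := -1) (by simp) fun a ↦ (a.val : ℝ) / p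
  rw [quadraticChar_neg_one_eq p hp2, if_pos hp, Int.cast_one, one_mul] at h1 h2
  -- With `χ_p` even and `∑ χ_p(a) = 0`, this reflection shows `∑ χ_p(a) a/p = 0`, so only the jump
  -- of the sawtooth survives.
  have h3 : ∑ a : ZMod p, (quadraticChar (ZMod p) a : ℝ) * (((-1 * a).val : ℝ) / p) =
      ∑ a : ZMod p, (quadraticChar (ZMod p) a : ℝ) * (1 - (a.val : ℝ) / p) := by
    refine sum_quadraticChar_mul_congr p fun a ha ↦ ?_
    rw [hval ha, Nat.cast_sub a.val_lt.le]
    field_simp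
  have h4 : ∑ a : ZMod p, (quadraticChar (ZMod p) a : ℝ) *
      (1 / 2 - Int.fract (1 / (k : ℝ) + a.val / p)) =
      ∑ a : ZMod p, (quadraticChar (ZMod p) a : ℝ) * ((1 / 2 - 1 / k) - (a.val : ℝ) / p +
        if k * (-1 * a).val < p then 1 else 0) := by
    refine sum_quadraticChar_mul_congr p fun a ha ↦ ?_
    rw [(fract_inv_add_div hk hp0.pos a.val_lt (mul_sub_val_ne hkp ha)).1, hval ha]
    ring
  have h0 := sum_quadraticChar_eq_zero p hp2
  rw [h4, quadraticExcess_zero_div_eq_sum p k (by omega)]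
  simp only [mul_sub, mul_add, mul_one, Finset.sum_sub_distrib, Finset.sum_add_distrib,
    ← Finset.sum_mul, h0] at h1 h2 h3 ⊢
  linarith

end QuadraticExcess

/-! ### Assembling the formulae -/

section Main

theorem DirichletCharacter.ne_one_of_apply_neg_one {N : ℕ} {χ : DirichletCharacter ℂ N}
    (h : χ (-1) = -1) : χ ≠ 1 := by
  rintro rfl
  rw [MulChar.one_apply isUnit_one.neg] at h
  norm_num at h

theorem pos_and_isPositiveMultipleOfLOne {N : ℕ} [NeZero N] {χ : DirichletCharacter ℂ N}
    (hre : ∀ a : ZMod N, (χ a).im = 0) (hodd : χ (-1) = -1)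
    {ι : Type*} (J : Finset ι) (c x : ι → ℝ) (hx : ∀ j ∈ J, c j ≠ 0 → Int.fract (x j) ≠ 0)
    (hχs : ∀ n : ℕ, χ (n : ZMod N) =
      ((∑ j ∈ J, c j * Real.sin (2 * Real.pi * x j * n) : ℝ) : ℂ))
    {q : ℤ} {C : ℝ} (hC : 0 < C)
    (hq : (q : ℝ) = C * ∑ j ∈ J, c j * (Real.pi * (1 / 2 - Int.fract (x j)))) :
    0 < q ∧ IsPositiveMultipleOfLOne q C χ := by
  have hχ := DirichletCharacter.ne_one_of_apply_neg_one hodd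
  obtain ⟨h1, h2⟩ := LFunction_one_of_eq_sum_sin hχ J c x hx hχs
  have h3 := LFunction_one_re_pos hχ hre h2
  refine ⟨?_, hre, hχ, h1, hC, ?_⟩
  · have : (0 : ℝ) < q := by
      rw [hq]
      exact mul_pos hC h3
    exact_mod_cast this
  · rw [h2, hq]
    push_cast
    rfl

theorem legendreChar_im (p : ℕ) [Fact p.Prime] (a : ZMod p) : (legendreChar p a).im = 0 :=
  Complex.intCast_im _

theorem prodChar_im {m n : ℕ} [NeZero (m * n)] {χ : DirichletCharacter ℂ m}
    {ψ : DirichletCharacter ℂ n} (hχ : ∀ a, (χ a).im = 0) (hψ : ∀ a, (ψ a).im = 0)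
    (a : ZMod (m * n)) : (prodChar χ ψ a).im = 0 := by
  have := prodChar_apply χ ψ (a.val : ℤ)
  rw [Int.cast_natCast, ZMod.natCast_zmod_val] at this
  rw [this, Complex.mul_im, hχ, hψ]
  simp

theorem legendreChar_neg_one (p : ℕ) [Fact p.Prime] (hp2 : p ≠ 2) :
    legendreChar p (-1) = if p % 4 = 1 then 1 else -1 := by
  have h : legendreChar p (-1) = ((quadraticChar (ZMod p) (-1) : ℤ) : ℂ) := rfl
  rw [h, quadraticChar_neg_one_eq p hp2]
  split_ifs <;> simp

/-- The case `p % 4 = 3` with `k = 2` or `k = 3`. -/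
theorem isPositiveMultipleOfLOne_legendreChar (p : ℕ) [Fact p.Prime] (hp : p % 4 = 3) (k : ℕ)
    (hk : k = 2 ∨ k = 3) (hkp : ¬ p ∣ k) :
    0 < quadraticExcess p 0 (p / k) ∧ IsPositiveMultipleOfLOne (quadraticExcess p 0 (p / k))
      (√(p : ℝ) / ((k - 1) * Real.pi) * (k - legendreSym p k)) (legendreChar p) := by
  have hp0 : p.Prime := Fact.out
  have hp2 : p ≠ 2 := by rintro rfl; omega
  have hpR : (0 : ℝ) < p := by exact_mod_cast hp0.pos
  have hs : 0 < √(p : ℝ) := Real.sqrt_pos.2 hpR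
  have hk2 : (2 : ℝ) ≤ k := by
    have : 2 ≤ k := by omega
    exact_mod_cast this
  have hfr (a : ZMod p) : Int.fract ((a.val : ℝ) / p) = (a.val : ℝ) / p := by
    rw [Int.fract_eq_self]
    refine ⟨by positivity, (div_lt_one hpR).2 ?_⟩
    exact_mod_cast a.val_lt
  have hleg : (legendreSym p k : ℝ) ≤ 1 := by
    have : legendreSym p k ≤ 1 := by
      rcases quadraticChar_isQuadratic (ZMod p) ((k : ℤ) : ZMod p) with h | h | h <;>
        rw [legendreSym, h] <;> norm_num
    exact_mod_cast this
  refine pos_and_isPositiveMultipleOfLOne (legendreChar_im p) ?_ Finset.univ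
    (fun a : ZMod p ↦ (quadraticChar (ZMod p) a : ℝ) / √p) (fun a ↦ (a.val : ℝ) / p) ?_ ?_ ?_ ?_
  · rw [legendreChar_neg_one p hp2, if_neg (by omega)]
  · intro a _ ha
    rw [hfr]
    have ha0 : a ≠ 0 := by rintro rfl; simp at ha
    have : (a.val : ℝ) ≠ 0 := by
      rwa [Nat.cast_ne_zero, Ne, ZMod.val_eq_zero]
    positivity
  · intro n
    have h1 := sum_quadraticChar_mul_sin p hp n
    have h2 := legendreChar_apply p n
    rw [Int.cast_natCast] at h2
    rw [h2, ← Complex.ofReal_intCast]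
    congr 1
    rw [eq_comm, ← mul_right_cancel_iff_of_pos hs, ← h1, Finset.sum_mul]
    refine Finset.sum_congr rfl fun a _ ↦ ?_
    rw [mul_right_comm, div_mul_cancel₀ _ hs.ne', Int.cast_natCast, mul_right_comm (2 * Real.pi)]
  · exact mul_pos (div_pos hs (mul_pos (by linarith) Real.pi_pos)) (by linarith)
  · have h1 := sub_mul_sum_sawtooth p hp k hk hkp
    have h2 : ∑ a : ZMod p, (quadraticChar (ZMod p) a : ℝ) / √p *
        (Real.pi * (1 / 2 - Int.fract ((a.val : ℝ) / p))) = Real.pi / √p *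
        ∑ a : ZMod p, (quadraticChar (ZMod p) a : ℝ) * (1 / 2 - (a.val : ℝ) / p) := by
      rw [Finset.mul_sum]
      refine Finset.sum_congr rfl fun a _ ↦ ?_
      rw [hfr]
      ring
    have hk1 : (k : ℝ) - 1 ≠ 0 := by linarith
    have hpi := Real.pi_ne_zero
    rw [h2, eq_comm, ← mul_right_inj' hk1, ← h1]
    field_simp

/-- The case `p % 4 = 1` with an auxiliary odd character modulo `k`. -/
theorem isPositiveMultipleOfLOne_prodChar (p : ℕ) [Fact p.Prime] (hp : p % 4 = 1) (k : ℕ)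
    (hk : 1 < k) (hkp : ¬ p ∣ k) [NeZero (k * p)] (ψ : DirichletCharacter ℂ k)
    (hψre : ∀ a, (ψ a).im = 0) (hψodd : ψ (-1) = -1) {t : ℝ} (ht : 0 < t)
    (hψ : ∀ n : ℕ, ψ (n : ZMod k) = ((t * Real.sin (2 * Real.pi * (1 / k) * n) : ℝ) : ℂ)) :
    0 < quadraticExcess p 0 (p / k) ∧ IsPositiveMultipleOfLOne (quadraticExcess p 0 (p / k))
      (√(p : ℝ) / (t * Real.pi)) (prodChar ψ (legendreChar p)) := by
  have hp0 : p.Prime := Fact.out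
  have hp2 : p ≠ 2 := by rintro rfl; omega
  have hpR : (0 : ℝ) < p := by exact_mod_cast hp0.pos
  have hs : 0 < √(p : ℝ) := Real.sqrt_pos.2 hpR
  refine pos_and_isPositiveMultipleOfLOne (prodChar_im hψre (legendreChar_im p)) ?_ Finset.univ
    (fun a : ZMod p ↦ t / √p * (quadraticChar (ZMod p) a : ℝ))
    (fun a ↦ 1 / (k : ℝ) + (a.val : ℝ) / p) ?_ ?_ (by positivity) ?_
  · have := prodChar_apply ψ (legendreChar p) (-1)
    push_cast at this
    rw [this, hψodd, legendreChar_neg_one p hp2, if_pos hp, mul_one]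
  · intro a _ ha
    have ha0 : a ≠ 0 := by rintro rfl; simp at ha
    exact (fract_inv_add_div hk hp0.pos a.val_lt (mul_sub_val_ne hkp ha0)).2
  · intro n
    have h1 := sum_quadraticChar_mul_cos p hp n
    have h1' := sum_quadraticChar_mul_sin_eq_zero p hp n
    have h2 := prodChar_apply ψ (legendreChar p) n
    rw [legendreChar_apply] at h2
    rw [Int.cast_natCast, Int.cast_natCast, hψ] at h2
    rw [h2, ← Complex.ofReal_intCast, ← Complex.ofReal_mul]
    congr 1
    -- After the addition formula, the cosine sum gives `χ_p(n) √p` and the sine sum vanishes.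
    have h3 (a : ZMod p) : t / √p * (quadraticChar (ZMod p) a : ℝ) *
        Real.sin (2 * Real.pi * (1 / (k : ℝ) + (a.val : ℝ) / p) * n) =
        t / √p * Real.sin (2 * Real.pi * (1 / k) * n) * ((quadraticChar (ZMod p) a : ℝ) *
          Real.cos (2 * Real.pi * (n : ℤ) * ((a.val : ℝ) / p))) +
        t / √p * Real.cos (2 * Real.pi * (1 / k) * n) * ((quadraticChar (ZMod p) a : ℝ) *
          Real.sin (2 * Real.pi * (n : ℤ) * ((a.val : ℝ) / p))) := by
      rw [show 2 * Real.pi * (1 / (k : ℝ) + (a.val : ℝ) / p) * n = 2 * Real.pi * (1 / k) * n +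
        2 * Real.pi * (n : ℤ) * ((a.val : ℝ) / p) by push_cast; ring, Real.sin_add]
      ring
    rw [Finset.sum_congr rfl fun a _ ↦ h3 a, Finset.sum_add_distrib, ← Finset.mul_sum,
      ← Finset.mul_sum, h1, h1']
    field_simp
    ring
  · have h2 : ∑ a : ZMod p, t / √p * (quadraticChar (ZMod p) a : ℝ) *
        (Real.pi * (1 / 2 - Int.fract (1 / (k : ℝ) + (a.val : ℝ) / p))) = t * Real.pi / √p *
        ∑ a : ZMod p, (quadraticChar (ZMod p) a : ℝ) *
          (1 / 2 - Int.fract (1 / (k : ℝ) + a.val / p)) := by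
      rw [Finset.mul_sum]
      refine Finset.sum_congr rfl fun a _ ↦ ?_
      ring
    have hpi := Real.pi_ne_zero
    rw [h2, sum_quadraticChar_mul_sawtooth_shift p hp k hk hkp]
    field_simp

theorem chiFour_natCast_eq_sin (n : ℕ) :
    chiFour (n : ZMod 4) = ((1 * Real.sin (2 * Real.pi * (1 / (4 : ℕ)) * n) : ℝ) : ℂ) := by
  have h := chiFour_apply n
  rw [Int.cast_natCast] at h
  rw [h]
  obtain ⟨q, r, hr, rfl⟩ : ∃ q r, r < 4 ∧ n = 4 * q + r :=
    ⟨n / 4, n % 4, Nat.mod_lt _ (by norm_num), (Nat.div_add_mod n 4).symm⟩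
  have h2 : Real.sin (2 * Real.pi * (1 / (4 : ℕ)) * (4 * q + r : ℕ)) =
      Real.sin (r * (Real.pi / 2)) := by
    rw [← Real.sin_add_nat_mul_two_pi (r * (Real.pi / 2)) q]
    congr 1
    push_cast
    ring
  rw [h2, one_mul]
  interval_cases r
  · rw [if_pos (by omega)]
    simp
  · rw [if_neg (by omega), if_pos (by omega)]
    simp
  · rw [if_pos (by omega), show ((2 : ℕ) : ℝ) * (Real.pi / 2) = Real.pi by push_cast; ring]
    simp
  · rw [if_neg (by omega), if_neg (by omega), show ((3 : ℕ) : ℝ) * (Real.pi / 2) =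
      Real.pi / 2 + Real.pi by push_cast; ring, Real.sin_add_pi]
    simp

theorem legendreChar_three_natCast_eq_sin [Fact (Nat.Prime 3)] (n : ℕ) :
    legendreChar 3 (n : ZMod 3) =
      ((2 / √3 * Real.sin (2 * Real.pi * (1 / (3 : ℕ)) * n) : ℝ) : ℂ) := by
  have h := legendreChar_apply 3 n
  rw [Int.cast_natCast] at h
  rw [h, legendreSym.mod]
  obtain ⟨q, r, hr, rfl⟩ : ∃ q r, r < 3 ∧ n = 3 * q + r :=
    ⟨n / 3, n % 3, Nat.mod_lt _ (by norm_num), (Nat.div_add_mod n 3).symm⟩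
  have h2 : Real.sin (2 * Real.pi * (1 / (3 : ℕ)) * (3 * q + r : ℕ)) =
      Real.sin (r * (2 * Real.pi / 3)) := by
    rw [← Real.sin_add_nat_mul_two_pi (r * (2 * Real.pi / 3)) q]
    congr 1
    push_cast
    ring
  rw [h2, show ((3 * q + r : ℕ) : ℤ) % (3 : ℕ) = (r : ℤ) by omega, ← Complex.ofReal_intCast]
  congr 1
  have h3 : Real.sin (2 * Real.pi / 3) = √3 / 2 := by
    rw [show 2 * Real.pi / 3 = Real.pi - Real.pi / 3 by ring, Real.sin_pi_sub,
      Real.sin_pi_div_three]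
  have h4 : Real.sin (2 * (2 * Real.pi / 3)) = -(√3 / 2) := by
    rw [show 2 * (2 * Real.pi / 3) = Real.pi / 3 + Real.pi by ring, Real.sin_add_pi,
      Real.sin_pi_div_three]
  have hs : √3 ≠ 0 := by positivity
  interval_cases r
  · simp [legendreSym.at_zero]
  · rw [Nat.cast_one, Nat.cast_one, legendreSym.at_one, one_mul, h3, Int.cast_one]
    field_simp
  · have : legendreSym 3 2 = -1 := by
      rw [legendreSym.at_two (by norm_num), ZMod.χ₈_nat_eq_if_mod_eight]
      norm_num
    rw [Nat.cast_ofNat, Nat.cast_ofNat, this, h4]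
    push_cast
    field_simp

end Main

theorem theorem7p1 (p : ℕ) [Fact p.Prime] :
    (p % 4 = 3 →
      0 < quadraticExcess p 0 (p / 2) ∧
      IsPositiveMultipleOfLOne (quadraticExcess p 0 (p / 2))
        (√(p : ℝ) / Real.pi * (2 - legendreSym p 2)) (legendreChar p)) ∧
    (p % 4 = 1 →
      0 < quadraticExcess p 0 (p / 4) ∧
      IsPositiveMultipleOfLOne (quadraticExcess p 0 (p / 4))
        (√(p : ℝ) / Real.pi) (prodChar chiFour (legendreChar p))) ∧
    (3 < p →
      0 < quadraticExcess p 0 (p / 3) ∧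
      (p % 4 = 1 →
        IsPositiveMultipleOfLOne (quadraticExcess p 0 (p / 3))
          (√(3 * p : ℝ) / (2 * Real.pi)) (prodChar (legendreChar 3) (legendreChar p))) ∧
      (p % 4 = 3 →
        IsPositiveMultipleOfLOne (quadraticExcess p 0 (p / 3))
          (√(p : ℝ) / (2 * Real.pi) * (3 - legendreSym p 3)) (legendreChar p))) := by
  have hp : p.Prime := Fact.out
  refine ⟨fun h ↦ ?_, fun h ↦ ?_, fun h3 ↦ ?_⟩
  · have := isPositiveMultipleOfLOne_legendreChar p h 2 (Or.inl rfl)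
      (Nat.not_dvd_of_pos_of_lt two_pos (by omega))
    norm_num at this
    exact this
  · have hp5 : 4 < p := by have := hp.two_le; omega
    have := isPositiveMultipleOfLOne_prodChar p h 4 (by norm_num)
      (Nat.not_dvd_of_pos_of_lt four_pos hp5) chiFour (fun a ↦ Complex.intCast_im _)
      (by have := chiFour_apply (-1); norm_num at this; exact this) one_pos
      chiFour_natCast_eq_sin
    rw [one_mul] at this
    exact_mod_cast this
  · have hnd : ¬ p ∣ 3 := Nat.not_dvd_of_pos_of_lt three_pos h3
    have hA (h : p % 4 = 1) := isPositiveMultipleOfLOne_prodChar p h 3 (by norm_num) hnd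
      (legendreChar 3) (legendreChar_im 3) (by rw [legendreChar_neg_one 3 (by norm_num)]; norm_num)
      (t := 2 / √3) (by positivity) legendreChar_three_natCast_eq_sin
    have hB (h : p % 4 = 3) := isPositiveMultipleOfLOne_legendreChar p h 3 (Or.inr rfl) hnd
    -- The amplitude `t = 2/√3` of `χ_3` as a sine wave accounts for the factor `√3 / 2`.
    have hc : √(p : ℝ) / (2 / √3 * Real.pi) = √(3 * p : ℝ) / (2 * Real.pi) := by
      rw [Real.sqrt_mul (by norm_num)]
      field_simp
    rw [hc] at hA
    simp only [Nat.cast_ofNat] at hA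
    norm_num at hB
    have h4 : p % 4 = 1 ∨ p % 4 = 3 := by
      have := hp.eq_two_or_odd
      omega
    exact ⟨h4.elim (fun h ↦ (hA h).1) (fun h ↦ (hB h).1), fun h ↦ (hA h).2, fun h ↦ (hB h).2⟩
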